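/- Let $A$ be a qubit with state space $\mathbb{C}^2$ and $B$ a qudit with state space $\mathbb{C}^d$. Let $\rho$ be a density operator on $\mathbb{C}^2\otimes\mathbb{C}^d$ (positive semidefinite, of trace one) having at most two nonzero eigenvalues, counted with multiplicity (rank at most $2$). A pure-state decomposition $\{p_i,|\psi_i\rangle\}$ of $\rho$ consists of finitely many probabilities $p_i\ge 0$, $\sum_i p_i=1$, and unit vectors $|\psi_i\rangle$ with $\rho=\sum_i p_i|\psi_i\rangle\langle\psi_i|$. For an operator $\sigma$ on $\mathbb{C}^2\otimes\mathbb{C}^d$ put $$\widetilde{\sigma}=\operatorname{tr}(\sigma^\dagger)\,I\otimes I-\sigma_A^\dagger\otimes I-I\otimes\sigma_B^\dagger+\sigma^\dagger,\qquad \sigma_A=\operatorname{tr}_B\sigma,\quad \sigma_B=\operatorname{tr}_A\sigma.$$ The $I$-tangle of $\rho$ is $$\tau(\rho)=\min_{\{p_i,|\psi_i\rangle\}}\sum_i p_i\,\langle\psi_i|\widetilde{\rho_i}|\psi_i\rangle,\qquad \rho_i=|\psi_i\rangle\langle\psi_i|,$$ and the entanglement of formation of $\rho$ is $$\mathscr{F}(\rho)=\min_{\{p_i,|\psi_i\rangle\}}\sum_i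 p_i\,S(\operatorname{tr}_B|\psi_i\rangle\langle\psi_i|),\qquad S(\sigma)=-\operatorname{tr}(\sigma\log_2\sigma),$$ where both minima are over all pure-state decompositions of $\rho$. Then both minima are attained, $\tau(\rho)\le 1$, and $$\mathscr{F}(\rho)\le H\left(\tfrac12+\tfrac12\sqrt{1-\tau(\rho)}\right),$$ where $H(x)=-x\log_2x-(1-x)\log_2(1-x)$ is the binary entropy function (with $0\log_2 0=0$). -/

import Mathlib

open scoped Kronecker ComplexOrder

namespace QInfo

/-- The operator `|ψ⟩⟨ψ|` of a vector `ψ` of the bipartite space `ℂ^a ⊗ ℂ^b`, written in the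
computational basis indexed by `a × b`. -/
def ketbra {a b : Type*} (ψ : a × b → ℂ) : Matrix (a × b) (a × b) ℂ :=
  Matrix.vecMulVec ψ (star ψ)

/-- The reduced operator `M_A = tr_B M`. -/
def traceB {a b : Type*} [Fintype b] (M : Matrix (a × b) (a × b) ℂ) : Matrix a a ℂ :=
  Matrix.of fun i i' => ∑ j, M (i, j) (i', j)

/-- The reduced operator `M_B = tr_A M`. -/
def traceA {a b : Type*} [Fintype a] (M : Matrix (a × b) (a × b) ℂ) : Matrix b b ℂ :=
  Matrix.of fun j j' => ∑ i, M (i, j) (i, j')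

/-- Density operators: positive semidefinite of trace one. -/
structure IsDensity {m : Type*} [Fintype m] (ρ : Matrix m m ℂ) : Prop where
  posSemidef : ρ.PosSemidef
  trace_eq_one : ρ.trace = 1

/-- The spin flip (universal state inverter)
`tr(M†) I ⊗ I - M_A† ⊗ I - I ⊗ M_B† + M†` of an operator `M`. -/
def spinFlip {a b : Type*} [Fintype a] [Fintype b] [DecidableEq a] [DecidableEq b]
    (M : Matrix (a × b) (a × b) ℂ) : Matrix (a × b) (a × b) ℂ :=
  M.conjTranspose.trace • ((1 : Matrix a a ℂ) ⊗ₖ (1 : Matrix b b ℂ))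
    - (traceB M).conjTranspose ⊗ₖ (1 : Matrix b b ℂ)
    - (1 : Matrix a a ℂ) ⊗ₖ (traceA M).conjTranspose
    + M.conjTranspose

/-- The I-tangle `⟨ψ| spinFlip(|ψ⟩⟨ψ|) |ψ⟩` of a pure state `ψ`; this number is real. -/
def pureTangle {a b : Type*} [Fintype a] [Fintype b] [DecidableEq a] [DecidableEq b]
    (ψ : a × b → ℂ) : ℝ :=
  (star ψ ⬝ᵥ (spinFlip (ketbra ψ)).mulVec ψ).re

/-- A pure-state decomposition `ρ = ∑ₖ pₖ |ψₖ⟩⟨ψₖ|` with `n` terms: the `pₖ` are probabilities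
and the `ψₖ` are unit vectors. -/
structure PureDecomposition {a b : Type*} [Fintype a] [Fintype b]
    (ρ : Matrix (a × b) (a × b) ℂ) (n : ℕ) where
  p : Fin n → ℝ
  ψ : Fin n → a × b → ℂ
  p_nonneg : ∀ k, 0 ≤ p k
  sum_p : ∑ k, p k = 1
  unit : ∀ k, star (ψ k) ⬝ᵥ ψ k = 1
  sum_eq : ∑ k, (p k : ℂ) • ketbra (ψ k) = ρ

/-- All averages `∑ₖ pₖ G(ψₖ)` over finite pure-state decompositions of `ρ`. -/
def decompositionAverages {a b : Type*} [Fintype a] [Fintype b]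
    (G : (a × b → ℂ) → ℝ) (ρ : Matrix (a × b) (a × b) ℂ) : Set ℝ :=
  {t | ∃ (n : ℕ) (D : PureDecomposition ρ n), t = ∑ k, D.p k * G (D.ψ k)}

/-- The I-tangle of a mixed state: the least average I-tangle over pure-state decompositions. -/
noncomputable def iTangle {a b : Type*} [Fintype a] [Fintype b] [DecidableEq a] [DecidableEq b]
    (ρ : Matrix (a × b) (a × b) ℂ) : ℝ :=
  sInf (decompositionAverages pureTangle ρ)

/-- The von Neumann entropy `-tr (σ log₂ σ)`, through the eigenvalues of `σ`. -/
noncomputable def vonNeumannEntropy {m : Type*} [Fintype m] [DecidableEq m]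
    (σ : Matrix m m ℂ) (hσ : σ.IsHermitian) : ℝ :=
  -∑ i, hσ.eigenvalues i * Real.logb 2 (hσ.eigenvalues i)

theorem isHermitian_traceB_ketbra {a b : Type*} [Fintype b] (ψ : a × b → ℂ) :
    (traceB (ketbra ψ)).IsHermitian := by
  ext i i'
  simp [traceB, ketbra, Matrix.vecMulVec_apply, mul_comm]

/-- The entanglement of formation of a pure state: the entropy of its reduced state on `A`. -/
noncomputable def pureEntanglement {a b : Type*} [Fintype a] [Fintype b] [DecidableEq a]
    (ψ : a × b → ℂ) : ℝ :=
  vonNeumannEntropy (traceB (ketbra ψ)) (isHermitian_traceB_ketbra ψ)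

/-- The entanglement of formation of a mixed state: the least average pure-state entanglement
over pure-state decompositions. -/
noncomputable def entanglementOfFormation {a b : Type*} [Fintype a] [Fintype b] [DecidableEq a]
    (ρ : Matrix (a × b) (a × b) ℂ) : ℝ :=
  sInf (decompositionAverages pureEntanglement ρ)

/-- The binary entropy function, with logarithms to base 2. -/
noncomputable def binaryEntropy (x : ℝ) : ℝ :=
  -x * Real.logb 2 x - (1 - x) * Real.logb 2 (1 - x)

end QInfo

/-! For a unit vector of `ℂ² ⊗ ℂ^d` the reduced qubit has eigenvalues `x` and `1 - x`, so its tangle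
is `4 x (1 - x)` and its entropy `H(x)`. The tangle fixes `x` up to `x ↔ 1 - x`, hence the entropy
is `E(t) = H(1/2 + √(1 - t)/2)` at `t = 4 x (1 - x)`. Since `E` is concave on `[0, 1]`
(`concaveOn_entropyOfTangle`), Jensen's inequality on a tangle-optimal decomposition bounds its
average entanglement, and so the minimum, by `E(τ)`.

Both minima are attained because the averages of a continuous `G` form the slice over `ρ` of the
convex hull of the points `(|ψ⟩⟨ψ|, G ψ)`, which is compact by Carathéodory's theorem. -/

namespace QInfo

/-! ### Compactness of convex hulls in finite dimension -/

section ConvexHull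

/-- The set of convex combinations of `n` points of a compact set is compact. -/
theorem isCompact_setOf_convexCombinations {E : Type*} [AddCommGroup E] [Module ℝ E]
    [TopologicalSpace E] [ContinuousAdd E] [ContinuousSMul ℝ E] {s : Set E} (hs : IsCompact s)
    (n : ℕ) :
    IsCompact {x | ∃ (w : Fin n → ℝ) (z : Fin n → E), (∀ i, 0 ≤ w i) ∧ ∑ i, w i = 1 ∧
      (∀ i, z i ∈ s) ∧ ∑ i, w i • z i = x} := by
  have h1 : IsCompact (stdSimplex ℝ (Fin n) ×ˢ Set.pi Set.univ fun _ : Fin n => s) :=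
    (isCompact_stdSimplex ℝ (Fin n)).prod (isCompact_univ_pi fun _ => hs)
  have h2 : Continuous fun q : (Fin n → ℝ) × (Fin n → E) => ∑ i, q.1 i • q.2 i := by fun_prop
  convert h1.image h2 using 1
  ext x
  constructor
  · rintro ⟨w, z, hw, hw1, hz, rfl⟩
    exact ⟨(w, z), ⟨⟨hw, hw1⟩, fun i _ => hz i⟩, rfl⟩
  · rintro ⟨⟨w, z⟩, ⟨⟨hw, hw1⟩, hz⟩, rfl⟩
    exact ⟨w, z, hw, hw1, fun i => hz i trivial, rfl⟩

/-- Carathéodory's theorem. The bound on `n` is the point: it makes the hull a finite union of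
compact sets. -/
theorem mem_convexHull_iff_exists_fin {E : Type*} [AddCommGroup E] [Module ℝ E]
    [FiniteDimensional ℝ E] {s : Set E} {x : E} :
    x ∈ convexHull ℝ s ↔ ∃ n ≤ Module.finrank ℝ E + 1, ∃ (w : Fin n → ℝ) (z : Fin n → E),
      (∀ i, 0 ≤ w i) ∧ ∑ i, w i = 1 ∧ (∀ i, z i ∈ s) ∧ ∑ i, w i • z i = x := by
  constructor
  · intro hx
    obtain ⟨ι, _, z, w, hz, hind, hw, hw1, hx⟩ := eq_pos_convex_span_of_mem_convexHull hx
    let e := Fintype.equivFin ι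
    refine ⟨Fintype.card ι, hind.card_le_finrank_succ.trans (by gcongr; exact Submodule.finrank_le _),
      w ∘ e.symm, z ∘ e.symm, fun i => (hw _).le, ?_, fun i => hz ⟨_, rfl⟩, ?_⟩
    · rw [← hw1]; exact e.symm.sum_comp w
    · rw [← hx]; exact e.symm.sum_comp fun i => w i • z i
  · rintro ⟨n, -, w, z, hw, hw1, hz, hx⟩
    exact mem_convexHull_of_exists_fintype w z hw hw1 hz hx

/-- In finite dimension the convex hull of a compact set is compact. -/
theorem isCompact_convexHull {E : Type*} [AddCommGroup E] [Module ℝ E]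
    [TopologicalSpace E] [ContinuousAdd E] [ContinuousSMul ℝ E] [FiniteDimensional ℝ E]
    {s : Set E} (hs : IsCompact s) : IsCompact (convexHull ℝ s) := by
  have h := (Set.finite_Iic (Module.finrank ℝ E + 1)).isCompact_biUnion
    fun n _ => isCompact_setOf_convexCombinations hs n
  convert h using 1
  ext x
  rw [mem_convexHull_iff_exists_fin]
  simp only [Set.mem_iUnion, Set.mem_Iic, Set.mem_ofPred_eq, exists_prop]

end ConvexHull

/-! ### Attainment of the minima -/

section Decompositions

variable {a b : Type*} [Fintype a] [Fintype b]

theorem isCompact_setOf_unit : IsCompact {ψ : a × b → ℂ | star ψ ⬝ᵥ ψ = 1} := by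
  refine Metric.isCompact_of_isClosed_isBounded
    (isClosed_eq (by unfold dotProduct; fun_prop) continuous_const) ?_
  refine (Metric.isBounded_closedBall (x := (0 : a × b → ℂ)) (r := 1)).subset fun ψ hψ => ?_
  rw [mem_closedBall_zero_iff, pi_norm_le_iff_of_nonneg zero_le_one]
  intro i
  have h1 : ∑ j, ‖ψ j‖ ^ 2 = 1 := by
    have h : star ψ ⬝ᵥ ψ = 1 := hψ
    have h' : ((∑ j, ‖ψ j‖ ^ 2 : ℝ) : ℂ) = 1 := by
      rw [← h]
      simp [dotProduct, Complex.conj_mul']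
    exact_mod_cast h'
  have h2 : ‖ψ i‖ ^ 2 ≤ ∑ j, ‖ψ j‖ ^ 2 :=
    Finset.single_le_sum (f := fun j => ‖ψ j‖ ^ 2) (fun j _ => sq_nonneg _) (Finset.mem_univ i)
  exact (sq_le_one_iff₀ (norm_nonneg _)).1 (h2.trans h1.le)

theorem continuous_ketbra {a b : Type*} :
    Continuous (ketbra : (a × b → ℂ) → Matrix (a × b) (a × b) ℂ) := by
  unfold ketbra Matrix.vecMulVec
  exact continuous_matrix fun i j => by simp only [Matrix.of_apply]; fun_prop

/-- Carrying the value of `G` alongside the projector turns decompositions of unbounded length into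
one convex hull in a finite-dimensional space. -/
theorem mem_decompositionAverages_iff (G : (a × b → ℂ) → ℝ) (ρ : Matrix (a × b) (a × b) ℂ)
    (t : ℝ) :
    t ∈ decompositionAverages G ρ ↔
      (ρ, t) ∈ convexHull ℝ ((fun ψ => (ketbra ψ, G ψ)) '' {ψ | star ψ ⬝ᵥ ψ = 1}) := by
  constructor
  · rintro ⟨n, D, rfl⟩
    refine mem_convexHull_of_exists_fintype D.p (fun k => (ketbra (D.ψ k), G (D.ψ k)))
      D.p_nonneg D.sum_p (fun k => ⟨D.ψ k, D.unit k, rfl⟩) ?_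
    ext1
    · simpa [Prod.fst_sum] using D.sum_eq
    · simp [Prod.snd_sum]
  · rw [mem_convexHull_iff_exists_fin]
    rintro ⟨n, -, w, z, hw, hw1, hz, hx⟩
    choose ψ hψ hz using hz
    have h1 := congrArg Prod.fst hx
    have h2 := congrArg Prod.snd hx
    simp only [← hz, Prod.fst_sum, Prod.snd_sum, Prod.smul_fst, Prod.smul_snd, smul_eq_mul]
      at h1 h2
    exact ⟨n, ⟨w, ψ, hw, hw1, hψ, by simpa using h1⟩, h2.symm⟩

theorem isCompact_decompositionAverages {G : (a × b → ℂ) → ℝ}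
    (hG : ContinuousOn G {ψ | star ψ ⬝ᵥ ψ = 1}) (ρ : Matrix (a × b) (a × b) ℂ) :
    IsCompact (decompositionAverages G ρ) := by
  have h1 := isCompact_convexHull
    (isCompact_setOf_unit.image_of_continuousOn (continuous_ketbra.continuousOn.prodMk hG))
  have h2 := (h1.inter_right (isClosed_singleton.preimage continuous_fst (t := {ρ}))).image
    continuous_snd
  convert h2 using 1
  ext t
  rw [mem_decompositionAverages_iff]
  constructor
  · exact fun h => ⟨(ρ, t), ⟨h, rfl⟩, rfl⟩
  · rintro ⟨⟨σ, _⟩, ⟨h, rfl⟩, rfl⟩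
    exact h

/-- The spectral decomposition of `ρ` is a pure-state decomposition. -/
theorem nonempty_decompositionAverages [DecidableEq a] [DecidableEq b] (G : (a × b → ℂ) → ℝ)
    {ρ : Matrix (a × b) (a × b) ℂ} (hρ : IsDensity ρ) : (decompositionAverages G ρ).Nonempty := by
  have hH := hρ.posSemidef.isHermitian
  let v : a × b → a × b → ℂ := fun k => (hH.eigenvectorBasis k).ofLp
  refine ⟨∑ k, hH.eigenvalues k * G (v k), (mem_decompositionAverages_iff G ρ _).2
    (mem_convexHull_of_exists_fintype hH.eigenvalues (fun k => (ketbra (v k), G (v k)))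
      hρ.posSemidef.eigenvalues_nonneg ?_ (fun k => ⟨v k, ?_, rfl⟩) ?_)⟩
  · have h := hH.trace_eq_sum_eigenvalues
    rw [hρ.trace_eq_one] at h
    have h' : ((∑ i, hH.eigenvalues i : ℝ) : ℂ) = 1 := by simpa using h.symm
    exact_mod_cast h'
  · have h := hH.eigenvectorBasis.orthonormal.1 k
    have h2 : inner ℂ (hH.eigenvectorBasis k) (hH.eigenvectorBasis k) = (1 : ℂ) := by
      rw [inner_self_eq_norm_sq_to_K, h]; simp
    rw [EuclideanSpace.inner_eq_star_dotProduct] at h2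
    rw [Set.mem_ofPred_eq, dotProduct_comm]
    exact h2
  · ext1
    · simp only [Prod.fst_sum, Prod.smul_fst]
      ext i j
      conv_rhs => rw [hH.spectral_theorem]
      simp only [Unitary.conjStarAlgAut_apply, Matrix.mul_apply, Matrix.diagonal_apply,
        Matrix.sum_apply, Matrix.smul_apply, ketbra, Matrix.vecMulVec_apply, v, Matrix.star_apply,
        Matrix.IsHermitian.eigenvectorUnitary_apply]
      refine Finset.sum_congr rfl fun k _ => ?_
      simp
      ring
    · simp [Prod.snd_sum]

theorem isLeast_sInf_decompositionAverages [DecidableEq a] [DecidableEq b]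
    {G : (a × b → ℂ) → ℝ} (hG : ContinuousOn G {ψ | star ψ ⬝ᵥ ψ = 1})
    {ρ : Matrix (a × b) (a × b) ℂ} (hρ : IsDensity ρ) :
    IsLeast (decompositionAverages G ρ) (sInf (decompositionAverages G ρ)) :=
  (isCompact_decompositionAverages hG ρ).isLeast_sInf (nonempty_decompositionAverages G hρ)

end Decompositions

/-! ### Tangle and spectrum of the reduced qubit -/

section Tangle

theorem continuous_pureTangle {a b : Type*} [Fintype a] [Fintype b] [DecidableEq a]
    [DecidableEq b] : Continuous (pureTangle : (a × b → ℂ) → ℝ) := by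
  unfold pureTangle spinFlip ketbra traceB traceA
  simp only [dotProduct, Matrix.mulVec, Matrix.add_apply, Matrix.sub_apply, Matrix.smul_apply,
    Matrix.kroneckerMap_apply, Matrix.conjTranspose_apply, Matrix.trace, Matrix.diag_apply,
    Matrix.vecMulVec_apply, Matrix.of_apply, smul_eq_mul]
  fun_prop

theorem traceB_ketbra_eq_mul_conjTranspose {a b : Type*} [Fintype b] (ψ : a × b → ℂ) :
    traceB (ketbra ψ) =
      (Matrix.of fun i j => ψ (i, j)) * (Matrix.of fun i j => ψ (i, j)).conjTranspose := by
  ext i i'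
  simp [traceB, ketbra, Matrix.vecMulVec_apply, Matrix.mul_apply]

theorem posSemidef_traceB_ketbra {a b : Type*} [Finite a] [Fintype b] (ψ : a × b → ℂ) :
    (traceB (ketbra ψ)).PosSemidef := by
  rw [traceB_ketbra_eq_mul_conjTranspose]
  exact Matrix.posSemidef_self_mul_conjTranspose _

theorem trace_traceB {a b : Type*} [Fintype a] [Fintype b] (M : Matrix (a × b) (a × b) ℂ) :
    (traceB M).trace = M.trace := by
  simp [Matrix.trace, traceB, Fintype.sum_prod_type]

theorem trace_ketbra {a b : Type*} [Fintype a] [Fintype b] (ψ : a × b → ℂ) :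
    (ketbra ψ).trace = star ψ ⬝ᵥ ψ := by
  rw [ketbra, Matrix.trace_vecMulVec, dotProduct_comm]

theorem dotProduct_kronecker_one_mulVec {a b : Type*} [Fintype a] [Fintype b] [DecidableEq b]
    (M : Matrix a a ℂ) (ψ : a × b → ℂ) :
    star ψ ⬝ᵥ (M ⊗ₖ (1 : Matrix b b ℂ)).mulVec ψ = (M * traceB (ketbra ψ)).trace := by
  simp only [dotProduct, Matrix.mulVec, Fintype.sum_prod_type, Matrix.kroneckerMap_apply,
    Matrix.one_apply, mul_ite, mul_one, mul_zero, ite_mul, zero_mul, Finset.sum_ite_eq,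
    Finset.mem_univ, if_true, Matrix.trace, Matrix.diag_apply, Matrix.mul_apply, traceB, ketbra,
    Matrix.vecMulVec_apply, Matrix.of_apply, Pi.star_apply, Finset.mul_sum]
  refine Finset.sum_congr rfl fun i _ => ?_
  rw [Finset.sum_comm]
  exact Finset.sum_congr rfl fun i' _ => Finset.sum_congr rfl fun j _ => by ring

theorem dotProduct_one_kronecker_mulVec {a b : Type*} [Fintype a] [Fintype b] [DecidableEq a]
    (N : Matrix b b ℂ) (ψ : a × b → ℂ) :
    star ψ ⬝ᵥ ((1 : Matrix a a ℂ) ⊗ₖ N).mulVec ψ = (N * traceA (ketbra ψ)).trace := by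
  simp only [dotProduct, Matrix.mulVec, Fintype.sum_prod_type_right, Matrix.kroneckerMap_apply,
    Matrix.one_apply, ite_mul, one_mul, zero_mul, Finset.sum_ite_eq,
    Finset.mem_univ, if_true, Matrix.trace, Matrix.diag_apply, Matrix.mul_apply, traceA, ketbra,
    Matrix.vecMulVec_apply, Matrix.of_apply, Pi.star_apply, Finset.mul_sum]
  refine Finset.sum_congr rfl fun j _ => ?_
  rw [Finset.sum_comm]
  exact Finset.sum_congr rfl fun j' _ => Finset.sum_congr rfl fun i _ => by ring

theorem traceA_ketbra_eq_transpose_mul {a b : Type*} [Fintype a] (ψ : a × b → ℂ) :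
    traceA (ketbra ψ) =
      (Matrix.of fun i j => ψ (i, j)).transpose *
        (Matrix.of fun i j => ψ (i, j)).conjTranspose.transpose := by
  ext j j'
  simp [traceA, ketbra, Matrix.vecMulVec_apply, Matrix.mul_apply]

/-- The two reduced states of a pure state have the same purity. -/
theorem trace_traceA_ketbra_sq {a b : Type*} [Fintype a] [Fintype b] (ψ : a × b → ℂ) :
    (traceA (ketbra ψ) * traceA (ketbra ψ)).trace =
      (traceB (ketbra ψ) * traceB (ketbra ψ)).trace := by
  rw [traceA_ketbra_eq_transpose_mul, traceB_ketbra_eq_mul_conjTranspose]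
  simp only [← Matrix.transpose_mul, Matrix.trace_transpose]
  rw [Matrix.mul_assoc, Matrix.trace_mul_comm]
  simp only [Matrix.mul_assoc]

/-- With `σ = tr_B |ψ⟩⟨ψ|`, the four terms of the spin flip contribute `(tr σ)²`, `-tr σ²`, `-tr σ²`
(equal purities) and `(tr σ)²`; for a `2 × 2` matrix `(tr σ)² - tr σ² = 2 det σ`. -/
theorem pureTangle_eq_four_mul_det {b : Type*} [Fintype b] [DecidableEq b]
    (ψ : Fin 2 × b → ℂ) : pureTangle ψ = 4 * (traceB (ketbra ψ)).det.re := by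
  have hA : (traceB (ketbra ψ)).conjTranspose = traceB (ketbra ψ) :=
    isHermitian_traceB_ketbra ψ
  have hB : (traceA (ketbra ψ)).conjTranspose = traceA (ketbra ψ) := by
    ext i i'
    simp [traceA, ketbra, Matrix.vecMulVec_apply, mul_comm]
  have hM : (ketbra ψ).conjTranspose = ketbra ψ := by
    ext i i'
    simp [ketbra, Matrix.vecMulVec_apply, mul_comm]
  have h : star ψ ⬝ᵥ (spinFlip (ketbra ψ)).mulVec ψ = 4 * (traceB (ketbra ψ)).det := by
    have hK : star ψ ⬝ᵥ (ketbra ψ).mulVec ψ = (traceB (ketbra ψ)).trace ^ 2 := by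
      rw [trace_traceB, trace_ketbra, ketbra, Matrix.vecMulVec_mulVec, dotProduct_smul, pow_two]
      rfl
    rw [spinFlip, hA, hB, hM, Matrix.add_mulVec, Matrix.sub_mulVec, Matrix.sub_mulVec,
      dotProduct_add, dotProduct_sub, dotProduct_sub, Matrix.smul_mulVec, dotProduct_smul,
      dotProduct_kronecker_one_mulVec, dotProduct_kronecker_one_mulVec,
      dotProduct_one_kronecker_mulVec, trace_traceA_ketbra_sq, hK, ← trace_traceB, one_mul,
      Matrix.det_fin_two]
    simp only [Matrix.trace_fin_two, Matrix.mul_apply, Fin.sum_univ_two, smul_eq_mul]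
    ring
  rw [pureTangle, h]
  simp

/-- The eigenvalues of the reduced state of a qubit are `x` and `1 - x`, where `4 x (1 - x)` is
the tangle. -/
theorem eigenvalues_traceB_ketbra {b : Type*} [Fintype b] [DecidableEq b]
    {ψ : Fin 2 × b → ℂ} (hψ : star ψ ⬝ᵥ ψ = 1) :
    ∃ x : ℝ, 0 ≤ x ∧ x ≤ 1 ∧ pureTangle ψ = 4 * x * (1 - x) ∧
      pureEntanglement ψ = binaryEntropy x := by
  have hH := isHermitian_traceB_ketbra ψ
  have hn := (posSemidef_traceB_ketbra ψ).eigenvalues_nonneg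
  have h1 := hH.trace_eq_sum_eigenvalues
  rw [trace_traceB, trace_ketbra, hψ, Fin.sum_univ_two] at h1
  have h1' : hH.eigenvalues 0 + hH.eigenvalues 1 = 1 := by
    have : ((hH.eigenvalues 0 + hH.eigenvalues 1 : ℝ) : ℂ) = 1 := by simpa using h1.symm
    exact_mod_cast this
  have h2 : hH.eigenvalues 1 = 1 - hH.eigenvalues 0 := by linarith
  refine ⟨hH.eigenvalues 0, hn 0, by linarith [hn 1], ?_, ?_⟩
  · rw [pureTangle_eq_four_mul_det, hH.det_eq_prod_eigenvalues, Fin.prod_univ_two, ← h2]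
    simp [mul_assoc]
  · rw [pureEntanglement, vonNeumannEntropy, Fin.sum_univ_two, h2, binaryEntropy]
    ring

end Tangle

/-! ### Concavity of entropy as a function of tangle -/

section Entropy

theorem binaryEntropy_eq_binEntropy_div (x : ℝ) :
    binaryEntropy x = Real.binEntropy x / Real.log 2 := by
  simp only [binaryEntropy, Real.binEntropy, Real.logb, Real.log_inv]
  ring

theorem binaryEntropy_one_sub (x : ℝ) : binaryEntropy (1 - x) = binaryEntropy x := by
  simp only [binaryEntropy_eq_binEntropy_div, Real.binEntropy_one_sub]

/-- The entropy of a qubit as a function of its tangle. -/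
noncomputable def entropyOfTangle (t : ℝ) : ℝ :=
  binaryEntropy (1 / 2 + 1 / 2 * Real.sqrt (1 - t))

theorem continuous_entropyOfTangle : Continuous entropyOfTangle := by
  unfold entropyOfTangle
  simp only [binaryEntropy_eq_binEntropy_div]
  fun_prop

theorem entropyOfTangle_four_mul (x : ℝ) :
    entropyOfTangle (4 * x * (1 - x)) = binaryEntropy x := by
  rw [entropyOfTangle, show 1 - 4 * x * (1 - x) = (2 * x - 1) ^ 2 by ring, Real.sqrt_sq_eq_abs]
  -- The root is `|2x - 1|`, so the argument of `H` is `x` or `1 - x`.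
  rcases abs_choice (2 * x - 1) with h | h
  · rw [h]; ring_nf
  · rw [h, ← binaryEntropy_one_sub x]; ring_nf

/-- The quotient has the power series `2 ∑ s^(2k) / (2k + 1)`, whose terms all increase with `s >
0`. -/
theorem log_sub_log_div_le {s t : ℝ} (hs : 0 < s) (hst : s ≤ t) (ht : t < 1) :
    (Real.log (1 + s) - Real.log (1 - s)) / s ≤ (Real.log (1 + t) - Real.log (1 - t)) / t := by
  have h1 := (Real.hasSum_log_sub_log_of_abs_lt_one
    (abs_lt.2 ⟨by linarith, hst.trans_lt ht⟩ : |s| < 1)).div_const s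
  have h2 := (Real.hasSum_log_sub_log_of_abs_lt_one
    (abs_lt.2 ⟨by linarith, ht⟩ : |t| < 1)).div_const t
  refine hasSum_le (fun k => ?_) h1 h2
  have ht0 := hs.trans_le hst
  rw [pow_succ, pow_succ, ← mul_assoc, ← mul_assoc, mul_div_cancel_right₀ _ hs.ne',
    mul_div_cancel_right₀ _ ht0.ne']
  gcongr

theorem hasDerivAt_entropyOfTangle {t : ℝ} (h0 : 0 < t) (h1 : t < 1) :
    HasDerivAt entropyOfTangle ((Real.log (1 + Real.sqrt (1 - t)) -
      Real.log (1 - Real.sqrt (1 - t))) / Real.sqrt (1 - t) / (4 * Real.log 2)) t := by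
  have hs0 : 0 < Real.sqrt (1 - t) := Real.sqrt_pos.2 (by linarith)
  have hs1 : Real.sqrt (1 - t) < 1 := by
    rw [Real.sqrt_lt' one_pos]; linarith
  have hd : HasDerivAt (fun t => 1 / 2 + 1 / 2 * Real.sqrt (1 - t))
      (1 / 2 * (-1 / (2 * Real.sqrt (1 - t)))) t :=
    ((((hasDerivAt_id t).const_sub 1).sqrt (by simp only [id]; linarith)).const_mul _).const_add _
  have hb := Real.hasDerivAt_binEntropy (p := 1 / 2 + 1 / 2 * Real.sqrt (1 - t))
    (by linarith) (by linarith)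
  have h := (hb.comp t hd).div_const (Real.log 2)
  have e : entropyOfTangle = fun t =>
      (Real.binEntropy ∘ fun t => 1 / 2 + 1 / 2 * Real.sqrt (1 - t)) t / Real.log 2 := by
    funext t
    simp [entropyOfTangle, binaryEntropy_eq_binEntropy_div]
  rw [e]
  refine h.congr_deriv ?_
  set s := Real.sqrt (1 - t)
  rw [show 1 - (1 / 2 + 1 / 2 * s) = (1 - s) / 2 by ring, show 1 / 2 + 1 / 2 * s = (1 + s) / 2 by
    ring, Real.log_div (by linarith) two_ne_zero, Real.log_div (by linarith) two_ne_zero]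
  have := Real.log_pos one_lt_two
  field_simp
  ring

/-- The derivative is an increasing function of `√(1 - t)`, hence decreasing in `t`; continuity
takes care of the endpoints. -/
theorem concaveOn_entropyOfTangle : ConcaveOn ℝ (Set.Icc 0 1) entropyOfTangle := by
  refine AntitoneOn.concaveOn_of_deriv (convex_Icc 0 1) continuous_entropyOfTangle.continuousOn
    ?_ ?_
  · rw [interior_Icc]
    exact fun t ht =>
      (hasDerivAt_entropyOfTangle ht.1 ht.2).differentiableAt.differentiableWithinAt
  · rw [interior_Icc]
    intro t ht u hu htu
    rw [(hasDerivAt_entropyOfTangle ht.1 ht.2).deriv, (hasDerivAt_entropyOfTangle hu.1 hu.2).deriv]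
    have hl := Real.log_pos one_lt_two
    refine div_le_div_of_nonneg_right (log_sub_log_div_le (Real.sqrt_pos.2 (by linarith [hu.2]))
      (Real.sqrt_le_sqrt (by linarith)) ?_) (by positivity)
    rw [Real.sqrt_lt' one_pos]
    linarith [ht.1]

end Entropy

/-! ### Entanglement of a pure state through its tangle -/

section Qubit

variable {b : Type*} [Fintype b] [DecidableEq b]

theorem pureTangle_mem_Icc {ψ : Fin 2 × b → ℂ} (hψ : star ψ ⬝ᵥ ψ = 1) :
    pureTangle ψ ∈ Set.Icc (0 : ℝ) 1 := by
  obtain ⟨x, h0, h1, ht, -⟩ := eigenvalues_traceB_ketbra hψ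
  rw [ht]
  exact ⟨mul_nonneg (by positivity) (by linarith), by nlinarith [sq_nonneg (2 * x - 1)]⟩

theorem pureEntanglement_eq_entropyOfTangle {ψ : Fin 2 × b → ℂ} (hψ : star ψ ⬝ᵥ ψ = 1) :
    pureEntanglement ψ = entropyOfTangle (pureTangle ψ) := by
  obtain ⟨x, -, -, ht, he⟩ := eigenvalues_traceB_ketbra hψ
  rw [he, ht, entropyOfTangle_four_mul]

/-- Factoring through the tangle, a polynomial in the coordinates and their conjugates, avoids any
continuity of eigenvalues. -/
theorem continuousOn_pureEntanglement :
    ContinuousOn (pureEntanglement : (Fin 2 × b → ℂ) → ℝ) {ψ | star ψ ⬝ᵥ ψ = 1} :=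
  (continuous_entropyOfTangle.comp continuous_pureTangle).continuousOn.congr
    fun _ hψ => pureEntanglement_eq_entropyOfTangle hψ

end Qubit

end QInfo

theorem mainTheorem2 (d : ℕ) (ρ : Matrix (Fin 2 × Fin d) (Fin 2 × Fin d) ℂ)
    (hρ : QInfo.IsDensity ρ) (hrank : ρ.rank ≤ 2) :
    IsLeast (QInfo.decompositionAverages QInfo.pureTangle ρ) (QInfo.iTangle ρ) ∧
    IsLeast (QInfo.decompositionAverages QInfo.pureEntanglement ρ)
      (QInfo.entanglementOfFormation ρ) ∧
    QInfo.iTangle ρ ≤ 1 ∧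
    QInfo.entanglementOfFormation ρ ≤
      QInfo.binaryEntropy (1 / 2 + 1 / 2 * Real.sqrt (1 - QInfo.iTangle ρ)) := by
  have hT : IsLeast (QInfo.decompositionAverages QInfo.pureTangle ρ) (QInfo.iTangle ρ) :=
    QInfo.isLeast_sInf_decompositionAverages QInfo.continuous_pureTangle.continuousOn hρ
  have hE : IsLeast (QInfo.decompositionAverages QInfo.pureEntanglement ρ)
      (QInfo.entanglementOfFormation ρ) :=
    QInfo.isLeast_sInf_decompositionAverages QInfo.continuousOn_pureEntanglement hρ
  -- `D` is optimal for the tangle; for the entanglement it is merely a competitor.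
  obtain ⟨n, D, hD⟩ := hT.1
  have hmem k := QInfo.pureTangle_mem_Icc (D.unit k)
  refine ⟨hT, hE, ?_, ?_⟩
  · rw [hD, ← D.sum_p]
    exact Finset.sum_le_sum fun k _ => mul_le_of_le_one_right (D.p_nonneg k) (hmem k).2
  · calc QInfo.entanglementOfFormation ρ
        ≤ ∑ k, D.p k * QInfo.pureEntanglement (D.ψ k) := hE.2 ⟨n, D, rfl⟩
      _ = ∑ k, D.p k • QInfo.entropyOfTangle (QInfo.pureTangle (D.ψ k)) := by
          simp only [QInfo.pureEntanglement_eq_entropyOfTangle (D.unit _), smul_eq_mul]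
      _ ≤ QInfo.entropyOfTangle (∑ k, D.p k • QInfo.pureTangle (D.ψ k)) :=
          QInfo.concaveOn_entropyOfTangle.le_map_sum (fun k _ => D.p_nonneg k) D.sum_p
            fun k _ => hmem k
      _ = QInfo.entropyOfTangle (QInfo.iTangle ρ) := by simp only [hD, smul_eq_mul]
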